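/- Let $k$ be a field of characteristic $p>0$ and let $X$ be a normal variety over $k$ (a normal integral separated scheme of finite type over $k$) which is $F$-finite, i.e. whose absolute Frobenius morphism $F\colon X\to X$ is finite. Let $\Delta\ge 0$ be an effective Weil $\mathbb{Q}$-divisor on $X$. (It is not required that $K_X+\Delta$ be $\mathbb{Q}$-Cartier.) The pair $(X,\Delta)$ is called *globally $F$-regular* if for every effective Weil divisor $D\ge 0$ on $X$ there is an integer $e>0$ such that the natural map $\mathcal{O}_X\to F^e_*\mathcal{O}_X(\lceil (p^e-1)\Delta\rceil+D)$ splits as a map of $\mathcal{O}_X$-modules. For an effective Weil $\mathbb{Q}$-divisor $\Gamma\ge 0$, the pair $(X,\Gamma)$ is called *globally $+$-regular* if for every finite dominant morphism $f\colon Y\to X$ from a normal integral scheme $Y$, the natural map $\mathcal{O}_X\to f_*\mathcal{O}_Y(\lfloor f^*\Gamma\rfloor)$ splits as a map of $\mathcal{O}_X$-modules. The pair $(X,\Delta)$ is called *strongly globally $+$-regular* if for every effective Weil divisor $D\ge 0$ on $X$ there is a rational number $\epsilon>0$ such that $(X,\Delta+\epsilon D)$ is globally $+$-regular. Then $(X,\Delta)$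 is globally $F$-regular if and only if it is strongly globally $+$-regular. -/

import Mathlib

open CategoryTheory TopologicalSpace Opposite AlgebraicGeometry

universe u

noncomputable section

namespace PlusRegular

/-! ### Normal schemes and prime divisors -/

/-- A scheme is normal if all its local rings are integrally closed domains. -/
class IsNormalScheme (X : Scheme.{u}) : Prop where
  isDomain_stalk : ∀ x : X, IsDomain (X.presheaf.stalk x)
  isIntegrallyClosed_stalk : ∀ x : X, IsIntegrallyClosed (X.presheaf.stalk x)

/-- Prime divisors, given by their generic points: the points of codimension one.
(In the order on `X`, the generic point is the largest element, so that `Order.coheight x` is the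
codimension of the closure of `x`, i.e. the dimension of the local ring at `x`.) -/
def PrimeDivisor (X : Scheme.{u}) : Type u := {x : X // Order.coheight x = 1}

/-- Weil divisors with integral coefficients (on a Noetherian scheme). -/
abbrev WeilDivisor (X : Scheme.{u}) : Type u := PrimeDivisor X →₀ ℤ

/-- Weil divisors with rational coefficients (on a Noetherian scheme). -/
abbrev QDivisor (X : Scheme.{u}) : Type u := PrimeDivisor X →₀ ℚ

variable {X Y : Scheme.{u}}

/-- An integral Weil divisor regarded as a `ℚ`-divisor. -/
def WeilDivisor.toQ (D : WeilDivisor X) : QDivisor X :=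
  D.mapRange (fun n : ℤ => (n : ℚ)) Int.cast_zero

/-- The round-down `⌊Δ⌋`, coefficient by coefficient. -/
def QDivisor.floor (Δ : QDivisor X) : WeilDivisor X :=
  Δ.mapRange (fun q : ℚ => ⌊q⌋) Int.floor_zero

/-- The round-up `⌈Δ⌉`, coefficient by coefficient. -/
def QDivisor.ceil (Δ : QDivisor X) : WeilDivisor X :=
  Δ.mapRange (fun q : ℚ => ⌈q⌉) Int.ceil_zero

/-! ### Pullback of divisors -/

/-- The ramification index of `f : Y ⟶ X` at `y`: the length of `𝒪_{Y,y} / 𝔪_{f y} 𝒪_{Y,y}`. When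
both local rings are discrete valuation rings, it is the order of vanishing at `y` of the pullback
of a local equation of the prime divisor `f y`. -/
def ramificationIndex (f : Y ⟶ X) (y : Y) : ℕ :=
  (Module.length (Y.presheaf.stalk y)
    (Y.presheaf.stalk y ⧸
      (IsLocalRing.maximalIdeal (X.presheaf.stalk (f y))).map (f.stalkMap y).hom)).toNat

open Classical in
/-- The coefficient of `f^*Δ` along the prime divisor `y`. -/
def pullbackCoeff (f : Y ⟶ X) (Δ : QDivisor X) (y : PrimeDivisor Y) : ℚ :=
  if h : Order.coheight (f y.1) = 1 then ramificationIndex f y.1 * Δ ⟨f y.1, h⟩ else 0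

/-- The pullback `f^*Δ` of a `ℚ`-divisor under a finite morphism: the coefficient of a prime divisor
of `Y` is the coefficient of its image in `X`, multiplied by the ramification index. -/
def QDivisor.pullback (f : Y ⟶ X) [IsFinite f] (Δ : QDivisor X) : QDivisor Y :=
  Finsupp.ofSupportFinite (pullbackCoeff f Δ) (by
    have hfin : {y : Y | f y ∈ Subtype.val '' (Δ.support : Set (PrimeDivisor X))}.Finite :=
      f.finite_preimage ((Δ.support.finite_toSet).image _)
    refine Set.Finite.subset (hfin.preimage (f := fun y : PrimeDivisor Y => y.1)
      (Subtype.val_injective.injOn)) ?_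
    intro y hy
    rw [Function.mem_support, pullbackCoeff] at hy
    split_ifs at hy with h
    · exact ⟨⟨f y.1, h⟩, Finsupp.mem_support_iff.2 (right_ne_zero_of_mul hy), rfl⟩
    · exact absurd rfl hy)

/-! ### The sheaf `𝒪_X(D)` -/

/-- The structure sheaf `𝒪_X` as an `𝒪_X`-module. -/
def structureSheaf (X : Scheme.{u}) : X.Modules := SheafOfModules.unit X.ringCatSheaf

section SheafOfDivisor

variable [IsIntegral X]

/-- The image in the function field `K(X)` of the germ of a function on `U`, at each point of `U`. -/
def germsInFunctionField (U : X.Opens) : Γ(X, U) →+* (U → X.functionField) :=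
  RingHom.pi fun x =>
    (algebraMap (X.presheaf.stalk x.1) X.functionField).comp (X.presheaf.germ U x.1 x.2).hom

theorem germsInFunctionField_const (U : X.Opens) (r : Γ(X, U)) (x y : U) :
    germsInFunctionField U r x = germsInFunctionField U r y := by
  have : Nonempty U := ⟨x⟩
  change algebraMap _ _ (X.presheaf.germ U x.1 x.2 r) = algebraMap _ _ (X.presheaf.germ U y.1 y.2 r)
  rw [Scheme.algebraMap_germ_eq_germToFunctionField, Scheme.algebraMap_germ_eq_germToFunctionField]

theorem germsInFunctionField_res {U V : X.Opens} (i : V ⟶ U) (r : Γ(X, U)) (x : V) :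
    germsInFunctionField V (X.presheaf.map i.op r) x = germsInFunctionField U r (i x) := by
  change algebraMap _ _ (X.presheaf.germ V x.1 x.2 (X.presheaf.map i.op r)) =
    algebraMap _ _ (X.presheaf.germ U x.1 (i.le x.2) r)
  rw [TopCat.Presheaf.germ_res_apply]

variable [IsLocallyNoetherian X]

theorem isDiscreteValuationRing_stalk [IsNormalScheme X] {x : X} (hx : Order.coheight x = 1) :
    IsDiscreteValuationRing (X.presheaf.stalk x) := by
  have h1 : IsIntegrallyClosed (X.presheaf.stalk x) := IsNormalScheme.isIntegrallyClosed_stalk x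
  have hdim := ringKrullDim_stalk_eq_coheight x
  rw [hx] at hdim
  have hle : Ring.KrullDimLE 1 (X.presheaf.stalk x) := krullDimLE_of_coheight_le hx.le
  have hnf : ¬ IsField (X.presheaf.stalk x) := by
    intro hf
    rw [ringKrullDim_eq_zero_of_isField hf] at hdim
    exact absurd hdim (by decide)
  have hd : IsDedekindDomain (X.presheaf.stalk x) :=
    { toIsDomain := inferInstance
      toIsDedekindRing :=
        { toIsNoetherian := inferInstance
          toDimensionLEOne :=
            ⟨fun {I} hI hp => Ring.krullDimLE_one_iff_of_noZeroDivisors.1 hle I hI hp⟩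
          toIsIntegralClosure := inferInstance } }
  exact ((IsDiscreteValuationRing.TFAE _ hnf).out 0 2).2 hd

/-- The condition on a function `s : U → K(X)` to be a section of `𝒪_X(D)`: it is constant, and its
value `φ` satisfies `φ = 0` or `ord_P φ + D(P) ≥ 0` for every prime divisor `P` meeting `U`. If `U` is
not empty, then such an `s` is the same as an element `φ` of `K(X)` with this property; if `U` is
empty, then there is exactly one such `s`. -/
def IsSectionOfDivisor (D : WeilDivisor X) {U : X.Opens} (s : U → X.functionField) : Prop :=
  (∀ x y : U, s x = s y) ∧
    ∀ (P : PrimeDivisor X) (hP : P.1 ∈ U), s ⟨P.1, hP⟩ = 0 ∨ 0 ≤ X.ord (s ⟨P.1, hP⟩) P.1 + D P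

/-- Sections of `𝒪_X(D)` over `U`. -/
def DivisorSections (D : WeilDivisor X) (U : X.Opens) : Type u :=
  {s : U → X.functionField // IsSectionOfDivisor D s}

theorem IsSectionOfDivisor.smul {D : WeilDivisor X} {U : X.Opens} (r : Γ(X, U))
    {s : U → X.functionField} (hs : IsSectionOfDivisor D s) :
    IsSectionOfDivisor D (germsInFunctionField U r * s) := by
  refine ⟨fun x y => ?_, fun P hP => ?_⟩
  · rw [Pi.mul_apply, Pi.mul_apply, germsInFunctionField_const U r x y, hs.1 x y]
  · have : Nonempty U := ⟨⟨P.1, hP⟩⟩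
    rcases hs.2 P hP with h | h
    · left
      rw [Pi.mul_apply, h, mul_zero]
    · by_cases hr : r = 0
      · left
        rw [hr, map_zero, zero_mul, Pi.zero_apply]
      · right
        have h2 : germsInFunctionField U r ⟨P.1, hP⟩ = X.germToFunctionField U r :=
          Scheme.algebraMap_germ_eq_germToFunctionField X hP r
        have h3 := Scheme.ord_le_smul hP hr (s ⟨P.1, hP⟩)
        rw [Algebra.smul_def] at h3
        rw [Pi.mul_apply, h2]
        exact h.trans (by gcongr; exact h3)

theorem IsSectionOfDivisor.zero (D : WeilDivisor X) (U : X.Opens) :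
    IsSectionOfDivisor D (0 : U → X.functionField) :=
  ⟨fun _ _ => rfl, fun _ _ => Or.inl rfl⟩

theorem IsSectionOfDivisor.neg {D : WeilDivisor X} {U : X.Opens}
    {s : U → X.functionField} (hs : IsSectionOfDivisor D s) : IsSectionOfDivisor D (-s) := by
  have h := hs.smul (-1 : Γ(X, U))
  rwa [map_neg, map_one, neg_one_mul] at h

theorem IsSectionOfDivisor.add [IsNormalScheme X] {D : WeilDivisor X} {U : X.Opens}
    {s t : U → X.functionField} (hs : IsSectionOfDivisor D s) (ht : IsSectionOfDivisor D t) :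
    IsSectionOfDivisor D (s + t) := by
  refine ⟨fun x y => ?_, fun P hP => ?_⟩
  · rw [Pi.add_apply, Pi.add_apply, hs.1 x y, ht.1 x y]
  · have := isDiscreteValuationRing_stalk P.2
    rw [Pi.add_apply]
    by_cases h0 : s ⟨P.1, hP⟩ + t ⟨P.1, hP⟩ = 0
    · exact Or.inl h0
    · rcases hs.2 P hP with h | h
      · rw [h, zero_add]
        exact ht.2 P hP
      · rcases ht.2 P hP with h' | h'
        · rw [h', add_zero]
          exact Or.inr h
        · right
          have h4 := Scheme.ord_add (x := P.1) h0
          rcases min_le_iff.1 h4 with h5 | h5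
          · exact h.trans (by gcongr)
          · exact h'.trans (by gcongr)

/-- Being a section of `𝒪_X(D)` is a local condition. -/
def divisorPredicate (D : WeilDivisor X) :
    TopCat.LocalPredicate (X := X.carrier) (fun _ => X.functionField) where
  pred {U} s := IsSectionOfDivisor D (U := U) s
  res i _ hs := ⟨fun x y => hs.1 (i x) (i y), fun P hP => hs.2 P (i.le hP)⟩
  locality {U} s hs := by
    refine ⟨fun x y => ?_, fun P hP => ?_⟩
    · obtain ⟨V, hxV, i, hV⟩ := hs x
      obtain ⟨W, hyW, j, hW⟩ := hs y
      obtain ⟨z, -, hzV, hzW⟩ := (PreirreducibleSpace.isPreirreducible_univ (X := X))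
        V W V.isOpen W.isOpen ⟨x, trivial, hxV⟩ ⟨y, trivial, hyW⟩
      exact (hV.1 ⟨x, hxV⟩ ⟨z, hzV⟩).trans (hW.1 ⟨z, hzW⟩ ⟨y, hyW⟩)
    · obtain ⟨V, hxV, i, hV⟩ := hs ⟨P.1, hP⟩
      exact hV.2 P hxV

/-- For `D ≥ 0`, the image of a function in `K(X)` is a section of `𝒪_X(D)`. -/
theorem isSectionOfDivisor_germs {D : WeilDivisor X} (hD : 0 ≤ D) (U : X.Opens) (r : Γ(X, U)) :
    IsSectionOfDivisor D (germsInFunctionField U r) := by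
  have h1 : IsSectionOfDivisor D (1 : U → X.functionField) := by
    refine ⟨fun _ _ => rfl, fun P hP => Or.inr ?_⟩
    have : Nonempty U := ⟨⟨P.1, hP⟩⟩
    have h := Scheme.ord_of_isUnit (X := X) (f := (1 : Γ(X, U))) isUnit_one hP
    rw [map_one] at h
    rw [Pi.one_apply, h, zero_add]
    exact hD P
  have h2 := h1.smul r
  rwa [mul_one] at h2

variable [IsNormalScheme X]

instance (D : WeilDivisor X) (U : X.Opens) : AddCommGroup (DivisorSections D U) :=
  inferInstanceAs (AddCommGroup
    ({ carrier := {s | IsSectionOfDivisor D s}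
       add_mem' := IsSectionOfDivisor.add
       zero_mem' := IsSectionOfDivisor.zero D U
       neg_mem' := IsSectionOfDivisor.neg } : AddSubgroup (U → X.functionField)))

instance (D : WeilDivisor X) (U : X.Opens) : Module Γ(X, U) (DivisorSections D U) where
  smul r s := ⟨germsInFunctionField U r * s.1, s.2.smul r⟩
  one_smul s := Subtype.ext ((congrArg (· * s.1) (map_one _)).trans (one_mul _))
  mul_smul r r' s := Subtype.ext
    ((congrArg (· * s.1) (map_mul (germsInFunctionField U) r r')).trans (mul_assoc _ _ _))
  smul_zero _ := Subtype.ext (mul_zero _)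
  smul_add _ _ _ := Subtype.ext (mul_add _ _ _)
  add_smul r r' s := Subtype.ext
    ((congrArg (· * s.1) (map_add (germsInFunctionField U) r r')).trans (add_mul _ _ _))
  zero_smul s := Subtype.ext ((congrArg (· * s.1) (map_zero _)).trans (zero_mul _))

/-- The presheaf of abelian groups underlying `𝒪_X(D)`: restriction is restriction of functions. -/
def divisorPresheaf (D : WeilDivisor X) : (X.Opens)ᵒᵖ ⥤ Ab.{u} where
  obj U := AddCommGrpCat.of (DivisorSections D U.unop)
  map {U V} i := AddCommGrpCat.ofHom
    { toFun := fun s => ⟨fun x => s.1 (i.unop x), (divisorPredicate D).res i.unop s.1 s.2⟩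
      map_zero' := rfl
      map_add' := fun _ _ => rfl }

instance (D : WeilDivisor X) (U : (X.Opens)ᵒᵖ) :
    Module (X.ringCatSheaf.obj.obj U) ((divisorPresheaf D).obj U) :=
  inferInstanceAs (Module Γ(X, U.unop) (DivisorSections D U.unop))

/-- The sheaf of `𝒪_X`-modules `𝒪_X(D)` of a Weil divisor `D` on a normal integral scheme: a
subsheaf of the constant sheaf of rational functions. -/
def sheafOfDivisor (D : WeilDivisor X) : X.Modules where
  val := PresheafOfModules.ofPresheaf (R := X.ringCatSheaf.obj) (divisorPresheaf D) (by
    intro U V i r s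
    refine Subtype.ext (funext fun x => ?_)
    exact congrArg (· * s.1 (i.unop x)) (germsInFunctionField_res i.unop r x).symm)
  isSheaf := by
    change TopCat.Presheaf.IsSheaf (X := X.carrier) (divisorPresheaf D)
    rw [TopCat.Presheaf.isSheaf_iff_isSheaf_comp (forget Ab.{u})]
    exact TopCat.subpresheafToTypes.isSheaf (divisorPredicate D)

/-- The inclusion `𝒪_X ⟶ 𝒪_X(D)` for an effective Weil divisor `D`. -/
def structureSheafToSheafOfDivisor (D : WeilDivisor X) (hD : 0 ≤ D) :
    structureSheaf X ⟶ sheafOfDivisor D where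
  val :=
    { app := fun U => ModuleCat.ofHom (R := Γ(X, U.unop)) (X := Γ(X, U.unop))
        (Y := DivisorSections D U.unop)
        { toFun := fun r => ⟨germsInFunctionField U.unop r, isSectionOfDivisor_germs hD U.unop r⟩
          map_add' := fun r r' => Subtype.ext (map_add _ r r')
          map_smul' := fun r r' => Subtype.ext (map_mul _ r r') }
      naturality := by
        intro U V i
        refine ModuleCat.hom_ext (LinearMap.ext fun r => ?_)
        exact Subtype.ext (funext fun x => germsInFunctionField_res i.unop r x) }

end SheafOfDivisor

section Splitting

variable [IsIntegral Y] [IsLocallyNoetherian Y] [IsNormalScheme Y]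

/-- The natural map of `𝒪_X`-modules `𝒪_X ⟶ f_*𝒪_Y ⟶ f_*(𝒪_Y(E))` for a morphism `f : Y ⟶ X` and an
effective Weil divisor `E` on `Y`. -/
def naturalMap (f : Y ⟶ X) (E : WeilDivisor Y) (hE : 0 ≤ E) :
    structureSheaf X ⟶
      (Scheme.Modules.pushforward f).obj (sheafOfDivisor E) :=
  SheafOfModules.unitToPushforwardObjUnit f.toRingCatSheafHom ≫
    (Scheme.Modules.pushforward f).map (structureSheafToSheafOfDivisor E hE)

/-- `E` is effective and the natural map `𝒪_X ⟶ f_*(𝒪_Y(E))` splits as a map of `𝒪_X`-modules, i.e.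
it has a left inverse. -/
def NaturalMapSplits (f : Y ⟶ X) (E : WeilDivisor Y) : Prop :=
  ∃ hE : 0 ≤ E, IsSplitMono (naturalMap f E hE)

end Splitting

/-! ### Global `+`-regularity -/

section GloballyPlusRegular

variable [IsIntegral X] [IsLocallyNoetherian X] [IsNormalScheme X]

/-- `(X, Δ)` is globally `+`-regular if `𝒪_X ⟶ f_*𝒪_Y(⌊f^*Δ⌋)` splits for every finite dominant
morphism `f : Y ⟶ X` with `Y` normal (and integral). Such a `Y` is automatically locally
Noetherian. -/
def IsGloballyPlusRegular (Δ : QDivisor X) : Prop :=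
  ∀ (Y : Scheme.{u}) [IsIntegral Y] [IsLocallyNoetherian Y] [IsNormalScheme Y]
    (f : Y ⟶ X) [IsFinite f] [IsDominant f],
    NaturalMapSplits f (QDivisor.floor (QDivisor.pullback f Δ))

/-- `(X, Δ)` is strongly globally `+`-regular if for every effective divisor `D` there is `ε > 0`
such that `(X, Δ + ε D)` is globally `+`-regular. -/
def IsStronglyGloballyPlusRegular (Δ : QDivisor X) : Prop :=
  ∀ D : WeilDivisor X, 0 ≤ D → ∃ ε : ℚ, 0 < ε ∧ IsGloballyPlusRegular (Δ + ε • D.toQ)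

end GloballyPlusRegular

/-! ### Frobenius and global `F`-regularity -/

/-- `X` has characteristic `p`, i.e. `p = 0` in `𝒪_X`. -/
def HasCharP (X : Scheme.{u}) (p : ℕ) : Prop := (p : Γ(X, ⊤)) = 0

theorem HasCharP.natCast_eq_zero {p : ℕ} (hX : HasCharP X p) (U : X.Opens) :
    (p : Γ(X, U)) = 0 := by
  have h := congrArg (X.presheaf.map (homOfLE le_top : U ⟶ ⊤).op) hX
  rwa [map_natCast, map_zero] at h

/-- A scheme over a field of characteristic `p` has characteristic `p`. -/
theorem HasCharP.of_hom_spec {k : Type u} [Field k] (p : ℕ) [CharP k p]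
    (s : X ⟶ Spec (CommRingCat.of k)) : HasCharP X p := by
  have h := congrArg ((Scheme.ΓSpecIso (CommRingCat.of k)).inv ≫ s.appTop) (CharP.cast_eq_zero k p)
  rwa [map_natCast, map_zero] at h

theorem add_pow_of_natCast_eq_zero {R : Type u} [CommRing R] {p : ℕ} [hp : Fact p.Prime]
    (h : (p : R) = 0) (e : ℕ) (a b : R) : (a + b) ^ p ^ e = a ^ p ^ e + b ^ p ^ e := by
  cases subsingleton_or_nontrivial R
  · exact Subsingleton.elim _ _
  · have : CharP R p := (CharP.charP_iff_prime_eq_zero hp.out).2 h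
    exact add_pow_char_pow a b p e

/-- The ring homomorphism `a ↦ a ^ (p ^ e)` of a ring in which the prime `p` is zero. -/
def frobeniusRingHom {R : Type u} [CommRing R] (p : ℕ) [hp : Fact p.Prime]
    (h : (p : R) = 0) (e : ℕ) : R →+* R where
  toFun a := a ^ p ^ e
  map_one' := one_pow _
  map_mul' a b := mul_pow a b _
  map_zero' := zero_pow (pow_ne_zero e hp.out.ne_zero)
  map_add' a b := add_pow_of_natCast_eq_zero h e a b

/-- The `e`-th iterate `F^e : X ⟶ X` of the absolute Frobenius as a morphism of ringed spaces. -/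
def frobeniusPresheafedSpaceHom (p : ℕ) [Fact p.Prime] (hX : HasCharP X p) (e : ℕ) :
    X.toPresheafedSpace.Hom X.toPresheafedSpace where
  base := 𝟙 _
  c :=
    { app := fun U => CommRingCat.ofHom (R := Γ(X, U.unop)) (S := Γ(X, U.unop))
        (frobeniusRingHom p (hX.natCast_eq_zero U.unop) e)
      naturality := by
        intro U V i
        ext r
        exact (map_pow (X.presheaf.map i).hom r (p ^ e)).symm }

/-- The `e`-th iterate `F^e : X ⟶ X` of the absolute Frobenius morphism of a scheme of
characteristic `p`: the identity on points, and `a ↦ a ^ (p ^ e)` on functions. -/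
def absoluteFrobenius (p : ℕ) [hp : Fact p.Prime] (hX : HasCharP X p) (e : ℕ) : X ⟶ X where
  toHom := frobeniusPresheafedSpaceHom p hX e
  prop x := by
    refine ⟨fun a ha => ?_⟩
    obtain ⟨U, hxU, r, rfl⟩ := X.presheaf.exists_germ_eq a
    have h1 : (frobeniusPresheafedSpaceHom p hX e).stalkMap x (X.presheaf.germ U x hxU r) =
        (X.presheaf.germ U x hxU r) ^ p ^ e := by
      refine (PresheafedSpace.stalkMap_germ_apply (frobeniusPresheafedSpaceHom p hX e) U x hxU r).trans
        ?_
      exact map_pow (X.presheaf.germ U x hxU).hom r (p ^ e)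
    have h2 := ha
    erw [h1] at h2
    exact (isUnit_pow_iff (pow_ne_zero e hp.out.ne_zero)).1 h2

/-- A scheme of characteristic `p` is `F`-finite if its absolute Frobenius morphism is finite. -/
def IsFFinite (p : ℕ) [Fact p.Prime] (hX : HasCharP X p) : Prop :=
  IsFinite (absoluteFrobenius p hX 1)

/-- `(X, Δ)` is globally `F`-regular if for every effective divisor `D` there is `e > 0` such that
`𝒪_X ⟶ F^e_*𝒪_X(⌈(p^e - 1)Δ⌉ + D)` splits. -/
def IsGloballyFRegular [IsIntegral X] [IsLocallyNoetherian X] [IsNormalScheme X]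
    (p : ℕ) [Fact p.Prime] (hX : HasCharP X p) (Δ : QDivisor X) : Prop :=
  ∀ D : WeilDivisor X, 0 ≤ D → ∃ e : ℕ, 0 < e ∧
    NaturalMapSplits (absoluteFrobenius p hX e)
      (QDivisor.ceil (((p : ℚ) ^ e - 1) • Δ) + D)

end PlusRegular

end

/-!
A splitting of `𝒪_X ⟶ f_*𝒪_Y(E)`, for `f : Y ⟶ X` finite and dominant, is the same thing as a
`K(X)`-linear map `K(Y) ⟶ K(X)` that sends `1` to `1` and rational functions with poles bounded by
`E` to functions without poles.

If `(X, Δ + ε(D + ⌈Δ⌉))` is globally `+`-regular, apply this to `Y = X` and `f = F^e`: pullback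
along `F^e` multiplies divisors by `p^e`, and `⌈(p^e - 1)Δ⌉ + D ≤ ⌊p^e(Δ + ε(D + ⌈Δ⌉))⌋` once
`p^e ε ≥ 1`.

Conversely, let `F^{e₀}` split along `⌈(p^{e₀} - 1)Δ⌉ + D`, and put `ε = p^{-e₀}` and
`Γ = Δ + εD`. A finite dominant `f : Y ⟶ X` need not be separable, so instead of a trace take any
`K(X)`-linear retraction `φ : K(Y) ⟶ K(X)` of `K(X) ⟶ K(Y)`. Its poles on regular functions are
bounded by a divisor `E` on `X`, and by the projection formula `φ` maps poles bounded by `f^*G` to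
poles bounded by `G + E`. If `F^{e₁}` splits along `⌈(p^{e₁} - 1)Δ⌉ + ⌈Δ⌉ + E` through
`ψ : K(X) ⟶ K(X)`, then `s ↦ ψ(φ(s^{p^{e₀ + e₁}}))` turns sections of `𝒪_Y(⌊f^*Γ⌋)` into sections
of `F^{e₀}_*𝒪_X(⌈(p^{e₀} - 1)Δ⌉ + D)`, compatibly with the maps from `𝒪_X`; composing with the
splitting of the latter splits `𝒪_X ⟶ f_*𝒪_Y(⌊f^*Γ⌋)`.
-/

noncomputable section

namespace PlusRegular

variable {X Y Z : Scheme.{u}}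

section FunctionField

variable [IsIntegral X] [IsIntegral Y] (f : Y ⟶ X) [IsDominant f]

theorem apply_genericPoint : f (genericPoint Y) = genericPoint X := by
  have h := (genericPoint_spec Y).image f.continuous
  rw [Set.image_univ, f.denseRange.closure_range] at h
  exact h.eq (genericPoint_spec X)

theorem genericPoint_mem_preimage {U : X.Opens} {x : X} (hx : x ∈ U) :
    genericPoint Y ∈ f ⁻¹ᵁ U :=
  ((specializes_of_eq (apply_genericPoint f)).trans (genericPoint_specializes x)).mem_open
    U.isOpen hx

/-- The extension of function fields `K(X) → K(Y)` of a dominant morphism `f : Y ⟶ X`. -/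
def functionFieldMap : X.functionField →+* Y.functionField :=
  (X.presheaf.stalkSpecializes (specializes_of_eq (apply_genericPoint f)) ≫
    f.stalkMap (genericPoint Y)).hom

theorem functionFieldMap_germToFunctionField {U : X.Opens} [Nonempty U]
    [Nonempty (f ⁻¹ᵁ U : Y.Opens)] (r : Γ(X, U)) :
    functionFieldMap f (X.germToFunctionField U r) =
      Y.germToFunctionField (f ⁻¹ᵁ U) (f.app U r) := by
  obtain ⟨x, hx⟩ := ‹Nonempty U›
  have h : genericPoint X ∈ U := (genericPoint_specializes x).mem_open U.isOpen hx
  change f.stalkMap (genericPoint Y) (X.presheaf.stalkSpecializes _ (X.presheaf.germ U _ h r)) = _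
  rw [TopCat.Presheaf.germ_stalkSpecializes_apply, Scheme.Hom.germ_stalkMap_apply]

theorem functionFieldMap_germsInFunctionField {U : X.Opens} (r : Γ(X, U)) (x : U)
    (y : (f ⁻¹ᵁ U : Y.Opens)) :
    functionFieldMap f (germsInFunctionField U r x) =
      germsInFunctionField (f ⁻¹ᵁ U) (f.app U r) y := by
  have : Nonempty U := ⟨x⟩
  have : Nonempty (f ⁻¹ᵁ U : Y.Opens) := ⟨y⟩
  exact (congrArg _ (Scheme.algebraMap_germ_eq_germToFunctionField X x.2 r)).trans
    ((functionFieldMap_germToFunctionField f r).trans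
      (Scheme.algebraMap_germ_eq_germToFunctionField Y y.2 (f.app U r)).symm)

theorem functionFieldMap_algebraMap (y : Y) (a : X.presheaf.stalk (f y)) :
    functionFieldMap f (algebraMap (X.presheaf.stalk (f y)) X.functionField a) =
      algebraMap (Y.presheaf.stalk y) Y.functionField (f.stalkMap y a) := by
  obtain ⟨U, hU, r, rfl⟩ := X.presheaf.exists_germ_eq a
  have : Nonempty U := ⟨⟨_, hU⟩⟩
  have : Nonempty (f ⁻¹ᵁ U : Y.Opens) := ⟨⟨y, hU⟩⟩
  rw [Scheme.algebraMap_germ_eq_germToFunctionField, functionFieldMap_germToFunctionField,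
    Scheme.Hom.germ_stalkMap_apply]
  exact (Scheme.algebraMap_germ_eq_germToFunctionField Y (U := f ⁻¹ᵁ U) hU _).symm

theorem exists_linear_retraction_functionFieldMap :
    ∃ φ : Y.functionField →+ X.functionField, φ 1 = 1 ∧
      ∀ k s, φ (functionFieldMap f k * s) = k * φ s := by
  let := (functionFieldMap f).toAlgebra
  obtain ⟨φ, hφ⟩ := LinearMap.exists_leftInverse_of_injective
    (Algebra.linearMap X.functionField Y.functionField)
    (LinearMap.ker_eq_bot.2 (functionFieldMap f).injective)
  refine ⟨φ.toAddMonoidHom, ?_, φ.map_smul⟩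
  simpa using LinearMap.congr_fun hφ 1

end FunctionField

section CodimensionOne

theorem lt_of_specializes_of_ne {x y : X} (h : y ⤳ x) (hne : x ≠ y) : x < y :=
  lt_of_le_not_ge (Scheme.le_iff_specializes.2 h) fun h' =>
    hne ((Scheme.le_iff_specializes.1 h').antisymm h).eq

theorem strictMono_of_isFinite (f : Y ⟶ X) [IsFinite f] : StrictMono f := by
  intro y z h
  have hzy : z ⤳ y := Scheme.le_iff_specializes.1 h.le
  refine lt_of_specializes_of_ne (hzy.map f.continuous) fun hfy => ?_
  have := (f.isDiscrete_preimage_singleton (f y)).to_subtype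
  have hfiber : (⟨z, hfy.symm⟩ : f ⁻¹' {f y}) ⤳ ⟨y, rfl⟩ :=
    Topology.IsInducing.subtypeVal.specializes_iff.1 hzy
  exact h.ne' (congrArg Subtype.val hfiber.eq)

variable [IsIntegral X]

theorem coheight_eq_zero_iff {x : X} : Order.coheight x = 0 ↔ x = genericPoint X := by
  refine ⟨fun h => ?_, fun h => h ▸ Order.coheight_top X⟩
  by_contra hx
  exact (Order.coheight_eq_zero.1 h).not_lt
    (lt_of_specializes_of_ne (genericPoint_specializes x) hx)

theorem PrimeDivisor.ne_genericPoint (P : PrimeDivisor X) : P.1 ≠ genericPoint X := fun h =>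
  one_ne_zero (P.2.symm.trans (coheight_eq_zero_iff.2 h))

theorem PrimeDivisor.eq_of_specializes (P : PrimeDivisor X) {x : X} (hx : x ≠ genericPoint X)
    (h : x ⤳ P.1) : x = P.1 := by
  by_contra hne
  have hle := Order.coheight_add_one_le (lt_of_specializes_of_ne h (Ne.symm hne))
  rw [P.2] at hle
  have h0 : Order.coheight x ≤ 0 :=
    (ENat.add_le_add_iff_right ENat.one_ne_top).1 (hle.trans (zero_add 1).ge)
  exact hx (coheight_eq_zero_iff.1 (nonpos_iff_eq_zero.1 h0))

theorem finite_primeDivisor_notMem [IsNoetherian X] (U : X.Opens) [Nonempty U] :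
    {P : PrimeDivisor X | P.1 ∉ U}.Finite := by
  obtain ⟨S, hS, hclosed, hirr, hSU⟩ := NoetherianSpace.exists_finite_set_isClosed_irreducible
    (isClosed_compl_iff.2 U.isOpen)
  refine Set.Finite.of_finite_image (f := fun P => closure {P.1}) (hS.subset ?_) ?_
  · rintro _ ⟨P, hP, rfl⟩
    obtain ⟨T, hT, hPT⟩ : P.1 ∈ ⋃₀ S := hSU ▸ hP
    have ht := (hirr T hT).isGenericPoint_genericPoint (hclosed T hT)
    have htU : (hirr T hT).genericPoint ∈ (U : Set X)ᶜ := hSU ▸ ⟨T, hT, ht.mem⟩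
    have ht' : (hirr T hT).genericPoint ≠ genericPoint X := fun h => by
      obtain ⟨x, hx⟩ := ‹Nonempty U›
      exact htU (h ▸ (genericPoint_specializes x).mem_open U.isOpen hx)
    rw [P.eq_of_specializes ht' (ht.specializes hPT)] at ht
    change closure {P.1} ∈ S
    rwa [ht.def]
  · intro P _ Q _ h
    exact Subtype.ext (IsGenericPoint.eq (isGenericPoint_closure.trans h) isGenericPoint_closure)

variable [IsIntegral Y] (f : Y ⟶ X) [IsDominant f]

theorem PrimeDivisor.apply_ne_genericPoint (hf : StrictMono f) (Q : PrimeDivisor Y) :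
    f Q.1 ≠ genericPoint X := by
  rw [← apply_genericPoint f]
  exact (hf (lt_of_specializes_of_ne (genericPoint_specializes Q.1) Q.ne_genericPoint)).ne

theorem PrimeDivisor.coheight_eq_one_of_apply_eq [IsFinite f] (P : PrimeDivisor X) {y : Y}
    (h : f y = P.1) : Order.coheight y = 1 := by
  refine le_antisymm ?_ ?_
  · rw [← P.2, ← h]
    exact Order.coheight_le_coheight_apply_of_strictMono _ (strictMono_of_isFinite f) y
  · rw [Order.one_le_iff_ne_zero, Ne, coheight_eq_zero_iff]
    rintro rfl
    exact P.ne_genericPoint (h.symm.trans (apply_genericPoint f))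

end CodimensionOne

section PoleOrder

variable [IsIntegral X] [IsLocallyNoetherian X]

/-- The rational function `s` is zero or has a pole of order at most `n` along `P`. This is the
condition imposed on sections of `𝒪_X(D)` along `P`, for `n = D P`. -/
def PrimeDivisor.PoleLE (P : PrimeDivisor X) (n : ℤ) (s : X.functionField) : Prop :=
  s = 0 ∨ 0 ≤ X.ord s P.1 + n

variable {P : PrimeDivisor X} {m n : ℤ} {s t : X.functionField}

theorem PrimeDivisor.PoleLE.mono (h : P.PoleLE m s) (hmn : m ≤ n) : P.PoleLE n s :=
  h.imp_right fun h => h.trans (by gcongr)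

theorem PrimeDivisor.PoleLE.mul (hs : P.PoleLE m s) (ht : P.PoleLE n t) :
    P.PoleLE (m + n) (s * t) := by
  rcases eq_or_ne s 0 with rfl | hs0
  · exact Or.inl (zero_mul t)
  rcases eq_or_ne t 0 with rfl | ht0
  · exact Or.inl (mul_zero s)
  refine Or.inr ?_
  rw [Scheme.ord_mul hs0 ht0]
  linarith [hs.resolve_left hs0, ht.resolve_left ht0]

theorem PrimeDivisor.PoleLE.add [IsNormalScheme X] (hs : P.PoleLE n s) (ht : P.PoleLE n t) :
    P.PoleLE n (s + t) := by
  have := isDiscreteValuationRing_stalk P.2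
  rcases eq_or_ne s 0 with rfl | hs0
  · rwa [zero_add]
  rcases eq_or_ne t 0 with rfl | ht0
  · rwa [add_zero]
  refine or_iff_not_imp_left.2 fun hst => ?_
  rcases min_le_iff.1 (Scheme.ord_add (x := P.1) hst) with h | h
  · linarith [hs.resolve_left hs0]
  · linarith [ht.resolve_left ht0]

theorem PrimeDivisor.poleLE_germToFunctionField (P : PrimeDivisor X) {U : X.Opens} [Nonempty U]
    (hP : P.1 ∈ U) (r : Γ(X, U)) : P.PoleLE 0 (X.germToFunctionField U r) := by
  rcases eq_or_ne r 0 with rfl | hr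
  · exact Or.inl (map_zero _)
  have h1 : X.ord (X.germToFunctionField U 1) P.1 = 0 := Scheme.ord_of_isUnit isUnit_one hP
  have h := Scheme.ord_le_smul hP hr (X.germToFunctionField U 1)
  rw [h1, Algebra.smul_def, map_one, mul_one] at h
  exact Or.inr (h.trans_eq (add_zero _).symm)

theorem PrimeDivisor.poleLE_algebraMap (P : PrimeDivisor X) (a : X.presheaf.stalk P.1) :
    P.PoleLE 0 (algebraMap (X.presheaf.stalk P.1) X.functionField a) := by
  obtain ⟨U, hU, r, rfl⟩ := X.presheaf.exists_germ_eq a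
  have : Nonempty U := ⟨⟨_, hU⟩⟩
  rw [Scheme.algebraMap_germ_eq_germToFunctionField]
  exact P.poleLE_germToFunctionField hU r

theorem PrimeDivisor.poleLE_one (P : PrimeDivisor X) : P.PoleLE 0 1 := by
  simpa using P.poleLE_algebraMap 1

theorem PrimeDivisor.PoleLE.pow (hs : P.PoleLE n s) (k : ℕ) : P.PoleLE (k * n) (s ^ k) := by
  induction k with
  | zero => simpa using P.poleLE_one
  | succ k ih =>
    rw [pow_succ]
    exact (ih.mul hs).mono (by push_cast; linarith)

theorem PrimeDivisor.ord_zpow (hs : s ≠ 0) (n : ℤ) : X.ord (s ^ n) P.1 = n * X.ord s P.1 := by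
  have h := (Scheme.ord_eq_iff P.2 hs).1 rfl
  rw [Scheme.ord_eq_iff P.2 (zpow_ne_zero n hs), map_zpow₀, h, ← WithZero.coe_zpow, ← ofAdd_zsmul,
    smul_eq_mul]

theorem PrimeDivisor.poleLE_zpow_mul_iff (hs : s ≠ 0) :
    P.PoleLE m (s ^ n * t) ↔ P.PoleLE (m + n * X.ord s P.1) t := by
  rcases eq_or_ne t 0 with rfl | ht
  · simp [PrimeDivisor.PoleLE]
  have hn := zpow_ne_zero n hs
  simp only [PrimeDivisor.PoleLE, mul_eq_zero, hn, ht, false_or, Scheme.ord_mul hn ht,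
    ord_zpow hs]
  constructor <;> intro h <;> linarith

end PoleOrder

section LocalRing

variable [IsIntegral X] [IsLocallyNoetherian X] [IsNormalScheme X] (P : PrimeDivisor X)

theorem PrimeDivisor.ord_algebraMap {a : X.presheaf.stalk P.1} (ha : a ≠ 0) {n : ℕ}
    (hn : Ring.ord (X.presheaf.stalk P.1) a = n) :
    X.ord (algebraMap (X.presheaf.stalk P.1) X.functionField a) P.1 = n := by
  have := isDiscreteValuationRing_stalk P.2
  have : Ring.KrullDimLE 1 (X.presheaf.stalk P.1) := krullDimLE_of_coheight_le P.2.le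
  rw [Scheme.ord_eq_iff P.2 ((map_ne_zero_iff _ (IsFractionRing.injective _ _)).2 ha)]
  exact (Ring.ordFrac_eq_ord (X.presheaf.stalk P.1) ha).trans
    (Ring.ordMonoidWithZeroHom_eq_coe _ (mem_nonZeroDivisors_of_ne_zero ha) hn)

theorem PrimeDivisor.ord_algebraMap_of_irreducible {ϖ : X.presheaf.stalk P.1}
    (hϖ : Irreducible ϖ) :
    X.ord (algebraMap (X.presheaf.stalk P.1) X.functionField ϖ) P.1 = 1 := by
  have := isDiscreteValuationRing_stalk P.2
  exact P.ord_algebraMap hϖ.ne_zero (n := 1) (by simpa using Ring.ord_of_irreducible hϖ)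

theorem PrimeDivisor.PoleLE.exists_algebraMap_eq {s : X.functionField} (h : P.PoleLE 0 s) :
    ∃ a, algebraMap (X.presheaf.stalk P.1) X.functionField a = s := by
  have := isDiscreteValuationRing_stalk P.2
  have : Ring.KrullDimLE 1 (X.presheaf.stalk P.1) := krullDimLE_of_coheight_le P.2.le
  rcases eq_or_ne s 0 with rfl | hs
  · exact ⟨0, map_zero _⟩
  have h1 : 1 ≤ Ring.ordFrac (X.presheaf.stalk P.1) s :=
    (Scheme.le_ord_iff P.2 hs).1 (by simpa using h.resolve_left hs)
  rw [Ring.ordFrac_eq_valuation_inv] at h1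
  exact IsDiscreteValuationRing.exists_lift_of_le_one ((one_le_inv_iff₀.1 h1).2)

end LocalRing

section Finiteness

variable [IsIntegral X] [IsNoetherian X]

theorem finite_not_poleLE_zero (s : X.functionField) :
    {P : PrimeDivisor X | ¬ P.PoleLE 0 s}.Finite := by
  rcases eq_or_ne s 0 with rfl | hs
  · exact Set.Finite.subset Set.finite_empty fun P hP => hP (Or.inl rfl)
  obtain ⟨U, -, t, _, rfl, -⟩ := exists_isUnit_germ_eq X s hs
  exact (finite_primeDivisor_notMem U).subset fun P hP hPU =>
    hP (P.poleLE_germToFunctionField hPU t)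

theorem exists_divisor_poleLE (s : X.functionField) :
    ∃ E : WeilDivisor X, 0 ≤ E ∧ ∀ P : PrimeDivisor X, P.PoleLE (E P) s := by
  rcases eq_or_ne s 0 with rfl | hs
  · exact ⟨0, le_rfl, fun P => Or.inl rfl⟩
  refine ⟨Finsupp.ofSupportFinite (fun P => max 0 (-X.ord s P.1))
    ((finite_not_poleLE_zero s).subset fun P hP h => hP ?_), fun P => le_max_left _ _, fun P => ?_⟩
  · exact max_eq_left (by linarith [h.resolve_left hs])
  · refine Or.inr ?_
    change 0 ≤ X.ord s P.1 + max 0 (-X.ord s P.1)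
    linarith [le_max_right 0 (-X.ord s P.1)]

theorem exists_divisor_forall_mem_poleLE (S : Finset X.functionField) :
    ∃ E : WeilDivisor X, 0 ≤ E ∧ ∀ s ∈ S, ∀ P : PrimeDivisor X, P.PoleLE (E P) s := by
  choose E hE hEs using exists_divisor_poleLE (X := X)
  refine ⟨∑ s ∈ S, E s, Finset.sum_nonneg fun s _ => hE s, fun s hs P => (hEs s P).mono ?_⟩
  exact Finset.single_le_sum (fun t _ => hE t) hs P

end Finiteness

section PolesOver

variable [IsIntegral Y]

/-- The rational function `s` on `Y` has poles bounded by `E` along the prime divisors of `Y` lying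
over the point `x`. -/
def PolesOverLE [IsLocallyNoetherian Y] (f : Y ⟶ X) (x : X) (E : PrimeDivisor Y → ℤ)
    (s : Y.functionField) : Prop :=
  ∀ Q : PrimeDivisor Y, f Q.1 = x → Q.PoleLE (E Q) s

theorem exists_open_forall_poleLE [IsNoetherian Y] (f : Y ⟶ X) {E : WeilDivisor Y} (hE : 0 ≤ E)
    {x : X} {s : Y.functionField} (h : ∀ Q : PrimeDivisor Y, f Q.1 ⤳ x → Q.PoleLE (E Q) s) :
    ∃ U : X.Opens, x ∈ U ∧ ∀ Q : PrimeDivisor Y, f Q.1 ∈ U → Q.PoleLE (E Q) s := by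
  have hfin : {Q : PrimeDivisor Y | ¬ Q.PoleLE (E Q) s}.Finite :=
    (finite_not_poleLE_zero s).subset fun Q hQ h0 => hQ (h0.mono (hE Q))
  let C : Set X := ⋃ Q ∈ {Q : PrimeDivisor Y | ¬ Q.PoleLE (E Q) s}, closure {f Q.1}
  have hC : IsClosed C := hfin.isClosed_biUnion fun _ _ => isClosed_closure
  refine ⟨⟨Cᶜ, hC.isOpen_compl⟩, fun hx => ?_, fun Q hQ => ?_⟩
  · obtain ⟨Q, hQ, hQx⟩ := Set.mem_iUnion₂.1 hx
    exact hQ (h Q (specializes_iff_mem_closure.2 hQx))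
  · by_contra hQE
    exact hQ (Set.mem_biUnion hQE (subset_closure rfl))

end PolesOver

section Transfer

variable [IsIntegral X]
  [IsIntegral Y] [IsLocallyNoetherian Y] [IsNormalScheme Y]
  [IsIntegral Z] [IsLocallyNoetherian Z] [IsNormalScheme Z]
  (f : Y ⟶ X) (g : Z ⟶ X) [IsDominant f] [IsDominant g]
  {E : WeilDivisor Y} {E' : WeilDivisor Z}

/-- A map `ψ : K(Y) → K(Z)` turning poles bounded by `E` into poles bounded by `E'`, applied to the
sections of `𝒪_Y(E)` over `f⁻¹(U)`. The values of sections are constant, so that it does not matter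
that they are read off at the generic point. -/
def DivisorSections.transfer (ψ : Y.functionField →+ Z.functionField)
    (hψE : ∀ (P : PrimeDivisor Z) s, PolesOverLE f (g P.1) E s → P.PoleLE (E' P) (ψ s))
    {U : X.Opens} (s : DivisorSections E (f ⁻¹ᵁ U)) : DivisorSections E' (g ⁻¹ᵁ U) :=
  ⟨fun z => ψ (s.1 ⟨genericPoint Y, genericPoint_mem_preimage f z.2⟩), fun _ _ => rfl,
    fun P hP => hψE P _ fun Q hQ => by
      have hQU : Q.1 ∈ f ⁻¹ᵁ U := show f Q.1 ∈ U from hQ ▸ hP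
      rw [s.2.1 _ ⟨Q.1, hQU⟩]
      exact s.2.2 Q hQU⟩

/-- The morphism `f_*𝒪_Y(E) ⟶ g_*𝒪_Z(E')` induced by a `K(X)`-linear map `ψ : K(Y) → K(Z)` turning
poles bounded by `E` into poles bounded by `E'`. -/
def transferHom (ψ : Y.functionField →+ Z.functionField)
    (hψ : ∀ k s, ψ (functionFieldMap f k * s) = functionFieldMap g k * ψ s)
    (hψE : ∀ (P : PrimeDivisor Z) s, PolesOverLE f (g P.1) E s → P.PoleLE (E' P) (ψ s)) :
    (Scheme.Modules.pushforward f).obj (sheafOfDivisor E) ⟶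
      (Scheme.Modules.pushforward g).obj (sheafOfDivisor E') where
  val :=
    { app := fun U => ModuleCat.ofHom (R := X.ringCatSheaf.obj.obj U)
        (X := ((Scheme.Modules.pushforward f).obj (sheafOfDivisor E)).val.obj U)
        (Y := ((Scheme.Modules.pushforward g).obj (sheafOfDivisor E')).val.obj U)
        { toFun := fun s => DivisorSections.transfer f g (E := E) (E' := E') ψ hψE s
          map_add' := fun _ _ => Subtype.ext (funext fun _ => map_add ψ _ _)
          map_smul' := fun r s => Subtype.ext (funext fun z => by
            let y : (f ⁻¹ᵁ U.unop : Y.Opens) := ⟨_, genericPoint_mem_preimage f z.2⟩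
            have h := hψ (germsInFunctionField U.unop r ⟨g z.1, z.2⟩) (s.1 y)
            rw [functionFieldMap_germsInFunctionField (U := U.unop) f r _ y,
              functionFieldMap_germsInFunctionField (U := U.unop) g r _ z] at h
            exact h) }
      naturality := fun _ => rfl }

variable {f g}

theorem NaturalMapSplits.of_transfer (hE : 0 ≤ E)
    (ψ : Y.functionField →+ Z.functionField) (hψ1 : ψ 1 = 1)
    (hψ : ∀ k s, ψ (functionFieldMap f k * s) = functionFieldMap g k * ψ s)
    (hψE : ∀ (P : PrimeDivisor Z) s, PolesOverLE f (g P.1) E s → P.PoleLE (E' P) (ψ s))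
    (h : NaturalMapSplits g E') : NaturalMapSplits f E := by
  obtain ⟨hE', ⟨⟨ρ, hρ⟩⟩⟩ := h
  have hψk (k) : ψ (functionFieldMap f k) = functionFieldMap g k := by
    simpa [hψ1] using hψ k 1
  have hcomp : naturalMap f E hE ≫ transferHom f g ψ hψ hψE = naturalMap g E' hE' := by
    refine Scheme.Modules.hom_ext _ _ fun U =>
      AddCommGrpCat.hom_ext (AddMonoidHom.ext fun r => Subtype.ext (funext fun z => ?_))
    let y : (f ⁻¹ᵁ U : Y.Opens) := ⟨_, genericPoint_mem_preimage f z.2⟩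
    have h := hψk (germsInFunctionField U r ⟨g z.1, z.2⟩)
    rw [functionFieldMap_germsInFunctionField f r _ y,
      functionFieldMap_germsInFunctionField g r _ z] at h
    exact h
  exact ⟨hE, ⟨⟨transferHom f g ψ hψ hψE ≫ ρ, by rw [← Category.assoc, hcomp, hρ]⟩⟩⟩

theorem NaturalMapSplits.mono {E E' : WeilDivisor Y} (hE : 0 ≤ E) (hEE' : E ≤ E')
    (h : NaturalMapSplits f E') : NaturalMapSplits f E :=
  .of_transfer hE (.id _) rfl (fun _ _ => rfl) (fun P _ hs => (hs P rfl).mono (hEE' P)) h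

end Transfer

section HomToStructureSheaf

theorem nonempty_inf [IsIntegral X] (U V : X.Opens) [Nonempty U] [Nonempty V] :
    Nonempty (U ⊓ V : X.Opens) := by
  obtain ⟨x, hx⟩ := nonempty_preirreducible_inter U.isOpen V.isOpen
    (Set.nonempty_coe_sort.1 ‹_›) (Set.nonempty_coe_sort.1 ‹_›)
  exact ⟨x, hx⟩

variable [IsIntegral X] [IsIntegral Y] {f : Y ⟶ X} {E : WeilDivisor Y}

/-- A rational function whose poles on `f⁻¹(U)` are bounded by `E`, as a section of `𝒪_Y(E)` over
`f⁻¹(U)`. -/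
def DivisorSections.ofFunction [IsLocallyNoetherian Y] (f : Y ⟶ X) {U : X.Opens}
    (s : Y.functionField) (hs : ∀ Q : PrimeDivisor Y, f Q.1 ∈ U → Q.PoleLE (E Q) s) :
    DivisorSections E (f ⁻¹ᵁ U) :=
  ⟨fun _ => s, fun _ _ => rfl, hs⟩

theorem exists_open_nonempty_forall_poleLE [IsNoetherian Y] {f : Y ⟶ X} [IsDominant f]
    (hf : StrictMono f) (hE : 0 ≤ E) (s : Y.functionField) :
    ∃ U : X.Opens, Nonempty U ∧ ∀ Q : PrimeDivisor Y, f Q.1 ∈ U → Q.PoleLE (E Q) s := by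
  obtain ⟨U, hU, hs⟩ := exists_open_forall_poleLE f hE (x := genericPoint X) (s := s) fun Q hQ =>
    absurd (hQ.antisymm (genericPoint_specializes _)).eq (Q.apply_ne_genericPoint f hf)
  exact ⟨U, ⟨_, hU⟩, hs⟩

section

variable [IsLocallyNoetherian Y] [IsNormalScheme Y]
  (ρ : (Scheme.Modules.pushforward f).obj (sheafOfDivisor E) ⟶ structureSheaf X)

/-- The rational function on `X` that is the image under `ρ : f_*𝒪_Y(E) ⟶ 𝒪_X` of a rational
function on `Y`, regarded as a section of `𝒪_Y(E)` over `f⁻¹(U)`. -/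
def imageOfFunction {U : X.Opens} [Nonempty U] (s : Y.functionField)
    (hs : ∀ Q : PrimeDivisor Y, f Q.1 ∈ U → Q.PoleLE (E Q) s) : X.functionField :=
  X.germToFunctionField U ((ρ.app U).hom (DivisorSections.ofFunction (E := E) f s hs))

variable {ρ} {U V : X.Opens} [Nonempty U] [Nonempty V] {s t : Y.functionField}
  {hs : ∀ Q : PrimeDivisor Y, f Q.1 ∈ U → Q.PoleLE (E Q) s}
  {ht : ∀ Q : PrimeDivisor Y, f Q.1 ∈ U → Q.PoleLE (E Q) t}

theorem imageOfFunction_mono (hVU : V ≤ U) :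
    imageOfFunction ρ (U := V) s (fun Q hQ => hs Q (hVU hQ)) = imageOfFunction ρ s hs := by
  have h := ConcreteCategory.congr_hom (ρ.mapPresheaf.naturality (homOfLE hVU).op)
    (DivisorSections.ofFunction (E := E) f s hs)
  exact (congrArg (X.germToFunctionField V) h).trans
    (X.presheaf.germ_res_apply (homOfLE hVU) _ _ _)

theorem imageOfFunction_add (hst : ∀ Q : PrimeDivisor Y, f Q.1 ∈ U → Q.PoleLE (E Q) (s + t)) :
    imageOfFunction ρ (s + t) hst = imageOfFunction ρ s hs + imageOfFunction ρ t ht :=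
  (congrArg (X.germToFunctionField U) (map_add (ρ.app U).hom (.ofFunction (E := E) f s hs)
    (.ofFunction (E := E) f t ht))).trans (map_add (X.germToFunctionField U).hom _ _)

theorem imageOfFunction_germ_mul [IsDominant f] {k : X.functionField} (r : Γ(X, U))
    (hr : X.germToFunctionField U r = k)
    (hks : ∀ Q : PrimeDivisor Y, f Q.1 ∈ U → Q.PoleLE (E Q) (functionFieldMap f k * s)) :
    imageOfFunction ρ (functionFieldMap f k * s) hks = k * imageOfFunction ρ s hs := by
  subst hr
  have h : DivisorSections.ofFunction (E := E) f _ hks =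
      f.app U r • DivisorSections.ofFunction (E := E) f s hs := by
    refine Subtype.ext (funext fun y => congrArg (· * s) ?_)
    rw [← functionFieldMap_germsInFunctionField f r ⟨f y.1, y.2⟩ y]
    exact congrArg _ (Scheme.algebraMap_germ_eq_germToFunctionField X _ r).symm
  exact (congrArg (X.germToFunctionField U) ((congrArg (ρ.app U).hom h).trans
    (ρ.app_smul (U := U) r _))).trans (map_mul (X.germToFunctionField U).hom _ _)

theorem imageOfFunction_mul [IsDominant f] (k : X.functionField)
    (hks : ∀ Q : PrimeDivisor Y, f Q.1 ∈ U → Q.PoleLE (E Q) (functionFieldMap f k * s)) :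
    imageOfFunction ρ (functionFieldMap f k * s) hks = k * imageOfFunction ρ s hs := by
  obtain ⟨W, hW, r, rfl⟩ := X.presheaf.exists_germ_eq k
  have : Nonempty W := ⟨⟨_, hW⟩⟩
  have := nonempty_inf W U
  rw [← imageOfFunction_mono (V := W ⊓ U) inf_le_right,
    ← imageOfFunction_mono (V := W ⊓ U) (hs := hs) inf_le_right]
  exact imageOfFunction_germ_mul (X.presheaf.map (homOfLE inf_le_left).op r)
    (X.presheaf.germ_res_apply _ _ _ _) _

theorem imageOfFunction_one {hE : 0 ≤ E} (hρ : naturalMap f E hE ≫ ρ = 𝟙 _)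
    (h1 : ∀ Q : PrimeDivisor Y, f Q.1 ∈ U → Q.PoleLE (E Q) 1) : imageOfFunction ρ 1 h1 = 1 := by
  have h := ConcreteCategory.congr_hom (congrArg (fun φ => Scheme.Modules.Hom.app φ U) hρ)
    (1 : Γ(X, U))
  have hone : DivisorSections.ofFunction (E := E) f 1 h1 =
      ((naturalMap f E hE).app U).hom (1 : Γ(X, U)) :=
    Subtype.ext ((map_one (germsInFunctionField (f ⁻¹ᵁ U))).symm.trans
      (congrArg (germsInFunctionField (f ⁻¹ᵁ U)) (map_one (f.app U).hom).symm))
  exact (congrArg (X.germToFunctionField U) ((congrArg (ρ.app U).hom hone).trans h)).trans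
    (map_one (X.germToFunctionField U).hom)

end

variable [IsNoetherian Y] [IsNormalScheme Y] [IsDominant f]

theorem exists_linear_map_of_hom (hf : StrictMono f) (hE : 0 ≤ E)
    (ρ : (Scheme.Modules.pushforward f).obj (sheafOfDivisor E) ⟶ structureSheaf X) :
    ∃ φ : Y.functionField →+ X.functionField,
      (∀ k s, φ (functionFieldMap f k * s) = k * φ s) ∧
      ∀ (U : X.Opens) [Nonempty U] (s : Y.functionField)
        (hs : ∀ Q : PrimeDivisor Y, f Q.1 ∈ U → Q.PoleLE (E Q) s),
        φ s = imageOfFunction ρ s hs := by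
  choose U hU hs using exists_open_nonempty_forall_poleLE hf hE
  have hwd (s) (V : X.Opens) [Nonempty V] (hsV) :
      imageOfFunction ρ s (hs s) = imageOfFunction ρ (U := V) s hsV := by
    have := nonempty_inf (U s) V
    exact (imageOfFunction_mono (V := U s ⊓ V) inf_le_left).symm.trans
      (imageOfFunction_mono (hs := hsV) inf_le_right)
  refine ⟨.mk' (fun s => imageOfFunction ρ s (hs s)) fun s t => ?_, fun k s => ?_,
    fun V _ s hsV => hwd s V hsV⟩
  · have := nonempty_inf (U s) (U t)
    have hs' (Q : PrimeDivisor Y) (hQ : f Q.1 ∈ U s ⊓ U t) := hs s Q hQ.1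
    have ht' (Q : PrimeDivisor Y) (hQ : f Q.1 ∈ U s ⊓ U t) := hs t Q hQ.2
    rw [hwd s _ hs', hwd t _ ht',
      hwd (s + t) _ fun Q hQ => (hs' Q hQ).add (ht' Q hQ), imageOfFunction_add]
  · have := nonempty_inf (U (functionFieldMap f k * s)) (U s)
    have hks' (Q : PrimeDivisor Y) (hQ : f Q.1 ∈ U (functionFieldMap f k * s) ⊓ U s) := hs _ Q hQ.1
    have hs' (Q : PrimeDivisor Y) (hQ : f Q.1 ∈ U (functionFieldMap f k * s) ⊓ U s) := hs s Q hQ.2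
    refine (hwd _ _ hks').trans ((imageOfFunction_mul k (hs := hs') hks').trans ?_)
    exact congrArg (k * ·) (hwd s _ hs').symm

theorem NaturalMapSplits.exists_linear_retraction [IsLocallyNoetherian X]
    (hf : StrictMono f) (h : NaturalMapSplits f E) :
    ∃ φ : Y.functionField →+ X.functionField, φ 1 = 1 ∧
      (∀ k s, φ (functionFieldMap f k * s) = k * φ s) ∧
      ∀ (P : PrimeDivisor X) s, PolesOverLE f P.1 E s → P.PoleLE 0 (φ s) := by
  obtain ⟨hE, ⟨⟨ρ, hρ⟩⟩⟩ := h
  obtain ⟨φ, hφ, hφρ⟩ := exists_linear_map_of_hom hf hE ρ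
  have : Nonempty (⊤ : X.Opens) := ⟨⟨genericPoint X, trivial⟩⟩
  refine ⟨φ, ?_, hφ, fun P s hs => ?_⟩
  · rw [hφρ ⊤ 1 fun Q _ => Q.poleLE_one.mono (hE Q), imageOfFunction_one hρ]
  · obtain ⟨U, hPU, hU⟩ := exists_open_forall_poleLE f hE fun Q hQ =>
      hs Q (P.eq_of_specializes (Q.apply_ne_genericPoint f hf) hQ)
    have : Nonempty U := ⟨⟨_, hPU⟩⟩
    rw [hφρ U s hU]
    exact P.poleLE_germToFunctionField hPU _

end HomToStructureSheaf

section ProjectionFormula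

variable [IsIntegral X] [IsLocallyNoetherian X] [IsNormalScheme X]
  [IsIntegral Y] [IsLocallyNoetherian Y] [IsNormalScheme Y] (f : Y ⟶ X) [IsDominant f]

theorem ord_functionFieldMap_algebraMap_of_irreducible (Q : PrimeDivisor Y)
    (hQ : Order.coheight (f Q.1) = 1) {ϖ : X.presheaf.stalk (f Q.1)} (hϖ : Irreducible ϖ) :
    Y.ord (functionFieldMap f (algebraMap (X.presheaf.stalk (f Q.1)) X.functionField ϖ)) Q.1 =
      ramificationIndex f Q.1 := by
  have := isDiscreteValuationRing_stalk hQ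
  have := isDiscreteValuationRing_stalk Q.2
  have hne : f.stalkMap Q.1 ϖ ≠ 0 := fun h => by
    have h0 := functionFieldMap_algebraMap f Q.1 ϖ
    rw [h, map_zero, map_eq_zero, FaithfulSMul.algebraMap_eq_zero_iff] at h0
    exact hϖ.ne_zero h0
  rw [functionFieldMap_algebraMap]
  refine Q.ord_algebraMap hne ?_
  rw [ramificationIndex, hϖ.maximalIdeal_eq, Ideal.map_span, Set.image_singleton]
  exact (ENat.natCast_toNat (Ring.ord_ne_top (mem_nonZeroDivisors_of_ne_zero hne))).symm

variable {f} {φ : Y.functionField →+ X.functionField} {P : PrimeDivisor X} {E : PrimeDivisor Y → ℤ}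
  {d : ℤ}

/-- The local projection formula: multiply by the `n`-th power of a uniformizer at `P`. -/
theorem poleLE_add_of_polesOverLE_add_ramificationIndex_mul
    (hφ : ∀ k s, φ (functionFieldMap f k * s) = k * φ s)
    (hd : ∀ s, PolesOverLE f P.1 E s → P.PoleLE d (φ s)) {n : ℤ} {s : Y.functionField}
    (hs : PolesOverLE f P.1 (fun Q => E Q + ramificationIndex f Q.1 * n) s) :
    P.PoleLE (d + n) (φ s) := by
  have := isDiscreteValuationRing_stalk P.2
  obtain ⟨ϖ, hϖ⟩ := IsDiscreteValuationRing.exists_irreducible (X.presheaf.stalk P.1)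
  let π := algebraMap (X.presheaf.stalk P.1) X.functionField ϖ
  have hπ : π ≠ 0 := (map_ne_zero_iff _ (IsFractionRing.injective _ _)).2 hϖ.ne_zero
  have h := hd (functionFieldMap f (π ^ n) * s) fun Q hQ => by
    rw [map_zpow₀, PrimeDivisor.poleLE_zpow_mul_iff ((map_ne_zero _).2 hπ)]
    obtain ⟨x, hx⟩ := P
    obtain rfl : f Q.1 = x := hQ
    rw [ord_functionFieldMap_algebraMap_of_irreducible f Q hx hϖ, mul_comm n]
    exact hs Q rfl
  rwa [hφ, PrimeDivisor.poleLE_zpow_mul_iff hπ, P.ord_algebraMap_of_irreducible hϖ, mul_one] at h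

end ProjectionFormula

section

variable {R S L : Type*} [CommRing R] [CommRing S] [CommRing L] [Algebra R S] [Algebra S L]

theorem exists_notMem_algebraMap_smul_mem_range [Algebra.IsIntegral R S] (𝔭 : Ideal R) [𝔭.IsPrime]
    {s : L} (hs : ∀ (𝔮 : Ideal S) [𝔮.IsPrime], 𝔮.comap (algebraMap R S) = 𝔭 →
      ∃ b ∉ 𝔮, b • s ∈ Set.range (algebraMap S L)) :
    ∃ t ∉ 𝔭, algebraMap R S t • s ∈ Set.range (algebraMap S L) := by
  let I : Ideal S :=
    (LinearMap.range (Algebra.linearMap S L)).comap (LinearMap.toSpanSingleton S L s)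
  by_contra! h
  have hI : I.comap (algebraMap R S) ≤ 𝔭 := fun t ht => by
    by_contra htp
    exact h t htp ht
  obtain ⟨𝔮, hI𝔮, h𝔮, h𝔮𝔭⟩ := Ideal.exists_ideal_over_prime_of_isIntegral 𝔭 I hI
  obtain ⟨b, hb, hbs⟩ := hs 𝔮 h𝔮𝔭
  exact hb (hI𝔮 hbs)

end

section AffineOpen

variable {V : X.Opens} (hV : IsAffineOpen V)

theorem notMem_primeIdealOf_iff {x : X} (hx : x ∈ V) {t : Γ(X, V)} :
    t ∉ (hV.primeIdealOf ⟨x, hx⟩).asIdeal ↔ IsUnit (X.presheaf.germ V x hx t) := by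
  let := X.presheaf.algebra_section_stalk ⟨x, hx⟩
  have := hV.isLocalization_stalk ⟨x, hx⟩
  exact (IsLocalization.AtPrime.isUnit_to_map_iff (X.presheaf.stalk x)
    (hV.primeIdealOf ⟨x, hx⟩).asIdeal t).symm

theorem exists_primeIdealOf_eq_of_comap_eq {f : Y ⟶ X} [IsAffineHom f] {x : X} (hx : x ∈ V)
    (𝔮 : PrimeSpectrum Γ(Y, f ⁻¹ᵁ V))
    (h : 𝔮.comap (f.app V).hom = hV.primeIdealOf ⟨x, hx⟩) :
    ∃ y, f y = x ∧ ∃ hy : y ∈ f ⁻¹ᵁ V, (hV.preimage f).primeIdealOf ⟨y, hy⟩ = 𝔮 := by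
  have hW := hV.preimage f
  have hy : hW.fromSpec 𝔮 ∈ f ⁻¹ᵁ V := hW.range_fromSpec.le (Set.mem_range_self 𝔮)
  have h𝔮 : hW.primeIdealOf ⟨_, hy⟩ = 𝔮 :=
    hW.fromSpec.isOpenEmbedding.injective (hW.fromSpec_primeIdealOf ⟨_, hy⟩)
  refine ⟨_, ?_, hy, h𝔮⟩
  have hf := hV.comap_primeIdealOf_appLE (f := f) V _ hW le_rfl hy
  rw [h𝔮, Scheme.Hom.appLE_eq_app, h] at hf
  exact (hV.fromSpec_primeIdealOf _).symm.trans
    ((congrArg hV.fromSpec hf.symm).trans (hV.fromSpec_primeIdealOf _))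

theorem exists_notMem_primeIdealOf_smul_mem_range [IsIntegral X] [Nonempty V] {x : X} (hx : x ∈ V)
    (a : X.presheaf.stalk x) :
    ∃ b ∉ (hV.primeIdealOf ⟨x, hx⟩).asIdeal,
      b • algebraMap (X.presheaf.stalk x) X.functionField a ∈
        Set.range (algebraMap Γ(X, V) X.functionField) := by
  let := X.presheaf.algebra_section_stalk ⟨x, hx⟩
  have := hV.isLocalization_stalk ⟨x, hx⟩
  obtain ⟨⟨c, b⟩, hcb⟩ := IsLocalization.surj (hV.primeIdealOf ⟨x, hx⟩).asIdeal.primeCompl a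
  refine ⟨b, b.2, c, ?_⟩
  have h := congrArg (algebraMap (X.presheaf.stalk x) X.functionField) hcb
  rw [map_mul, mul_comm] at h
  rw [Algebra.smul_def]
  refine (Scheme.algebraMap_germ_eq_germToFunctionField X hx c).symm.trans (h.symm.trans ?_)
  exact congrArg (· * _) (Scheme.algebraMap_germ_eq_germToFunctionField X hx b.1)

include hV in
theorem exists_isUnit_germ_smul_mem_range [IsIntegral Y] {f : Y ⟶ X} [IsIntegralHom f]
    [Nonempty (f ⁻¹ᵁ V : Y.Opens)] {x : X} (hx : x ∈ V) {s : Y.functionField}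
    (hs : ∀ y, f y = x → ∃ a, algebraMap (Y.presheaf.stalk y) Y.functionField a = s) :
    ∃ t, IsUnit (X.presheaf.germ V x hx t) ∧
      f.app V t • s ∈ Set.range (algebraMap Γ(Y, f ⁻¹ᵁ V) Y.functionField) := by
  let := (f.app V).hom.toAlgebra
  have : Algebra.IsIntegral Γ(X, V) Γ(Y, f ⁻¹ᵁ V) := ⟨IsIntegralHom.isIntegral_app f V hV⟩
  obtain ⟨t, ht, hts⟩ := exists_notMem_algebraMap_smul_mem_range
    (hV.primeIdealOf ⟨x, hx⟩).asIdeal (s := s) fun 𝔮 h𝔮 h => by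
      obtain ⟨y, hyx, hy, hy𝔮⟩ :=
        exists_primeIdealOf_eq_of_comap_eq hV (f := f) hx ⟨𝔮, h𝔮⟩ (PrimeSpectrum.ext h)
      obtain ⟨a, rfl⟩ := hs y hyx
      have h := exists_notMem_primeIdealOf_smul_mem_range (hV.preimage f) hy a
      rwa [hy𝔮] at h
  exact ⟨t, (notMem_primeIdealOf_iff hV hx).1 ht, hts⟩

end AffineOpen

section DivisorBound

variable [IsIntegral X] [IsIntegral Y] {f : Y ⟶ X} [IsDominant f]
  {φ : Y.functionField →+ X.functionField}

theorem map_app_smul (hφ : ∀ k s, φ (functionFieldMap f k * s) = k * φ s) {V : X.Opens}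
    [Nonempty V] [Nonempty (f ⁻¹ᵁ V : Y.Opens)] (r : Γ(X, V)) (s : Y.functionField) :
    φ (f.app V r • s) = X.germToFunctionField V r * φ s := by
  rw [Algebra.smul_def, ← hφ, functionFieldMap_germToFunctionField]
  rfl

variable [IsFinite f]

theorem exists_finset_forall_poleLE_map_algebraMap [IsLocallyNoetherian X] [IsNormalScheme X]
    (hφ : ∀ k s, φ (functionFieldMap f k * s) = k * φ s) {V : X.Opens} (hV : IsAffineOpen V)
    [Nonempty V] [Nonempty (f ⁻¹ᵁ V : Y.Opens)] :
    ∃ S : Finset X.functionField, ∀ (P : PrimeDivisor X) (n : ℤ), P.1 ∈ V →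
      (∀ k ∈ S, P.PoleLE n k) → ∀ a : Γ(Y, f ⁻¹ᵁ V), P.PoleLE n (φ (algebraMap _ _ a)) := by
  classical
  let := (f.app V).hom.toAlgebra
  obtain ⟨T, hT⟩ : (⊤ : Submodule Γ(X, V) Γ(Y, f ⁻¹ᵁ V)).FG := (f.finite_app V hV).1
  refine ⟨T.image fun a => φ (algebraMap _ _ a), fun P n hP hS a => ?_⟩
  have ha : a ∈ Submodule.span Γ(X, V) (T : Set Γ(Y, f ⁻¹ᵁ V)) := hT ▸ Submodule.mem_top
  induction ha using Submodule.span_induction with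
  | mem a ha => exact hS _ (Finset.mem_image_of_mem _ ha)
  | zero => exact Or.inl (by rw [map_zero, map_zero])
  | add a b _ _ ha hb =>
    rw [map_add, map_add]
    exact ha.add hb
  | smul c a _ ha =>
    have h := (P.poleLE_germToFunctionField hP c).mul ha
    rwa [zero_add, ← map_app_smul hφ, Algebra.smul_def, ← map_mul] at h

variable [IsLocallyNoetherian Y] [IsNormalScheme Y]

theorem poleLE_map_of_polesOverLE_zero [IsLocallyNoetherian X]
    (hφ : ∀ k s, φ (functionFieldMap f k * s) = k * φ s) {V : X.Opens} (hV : IsAffineOpen V)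
    [Nonempty (f ⁻¹ᵁ V : Y.Opens)] {P : PrimeDivisor X} (hP : P.1 ∈ V) {n : ℤ}
    (h : ∀ a : Γ(Y, f ⁻¹ᵁ V), P.PoleLE n (φ (algebraMap _ _ a))) {s : Y.functionField}
    (hs : PolesOverLE f P.1 0 s) : P.PoleLE n (φ s) := by
  have : Nonempty V := ⟨⟨_, hP⟩⟩
  obtain ⟨t, ht, a, ha⟩ := exists_isUnit_germ_smul_mem_range hV hP fun y hy =>
    PrimeDivisor.PoleLE.exists_algebraMap_eq (P := ⟨y, P.coheight_eq_one_of_apply_eq f hy⟩)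
      (hs _ hy)
  obtain ⟨u, hu⟩ := ht.exists_left_inv
  have hmul := (P.poleLE_algebraMap u).mul (h a)
  rwa [zero_add, ha, map_app_smul hφ, ← Scheme.algebraMap_germ_eq_germToFunctionField X hP,
    ← mul_assoc, ← map_mul, hu, map_one, one_mul] at hmul

theorem exists_finset_forall_poleLE_map [IsLocallyNoetherian X] [IsNormalScheme X]
    (hφ : ∀ k s, φ (functionFieldMap f k * s) = k * φ s) {V : X.Opens} (hV : IsAffineOpen V) :
    ∃ S : Finset X.functionField, ∀ (P : PrimeDivisor X) (n : ℤ), P.1 ∈ V →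
      (∀ k ∈ S, P.PoleLE n k) → ∀ s, PolesOverLE f P.1 0 s → P.PoleLE n (φ s) := by
  by_cases hne : Nonempty V
  · obtain ⟨x, hx⟩ := hne
    have : Nonempty V := ⟨⟨x, hx⟩⟩
    have : Nonempty (f ⁻¹ᵁ V : Y.Opens) := ⟨⟨_, genericPoint_mem_preimage f hx⟩⟩
    obtain ⟨S, hS⟩ := exists_finset_forall_poleLE_map_algebraMap hφ hV
    exact ⟨S, fun P n hP hSn _ hs =>
      poleLE_map_of_polesOverLE_zero hφ hV hP (hS P n hP hSn) hs⟩
  · exact ⟨∅, fun P _ hP => absurd ⟨⟨_, hP⟩⟩ hne⟩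

theorem exists_divisor_poleLE_map [IsNoetherian X] [IsNormalScheme X]
    (hφ : ∀ k s, φ (functionFieldMap f k * s) = k * φ s) :
    ∃ E : WeilDivisor X, 0 ≤ E ∧ ∀ (P : PrimeDivisor X) s,
      PolesOverLE f P.1 0 s → P.PoleLE (E P) (φ s) := by
  classical
  obtain ⟨T, hT, hcover⟩ := (isCompact_iff_finite_and_eq_biUnion_affineOpens (U := ⊤)).1
    (CompactSpace.isCompact_univ (X := X))
  choose S hS using fun V : X.affineOpens => exists_finset_forall_poleLE_map hφ V.2
  obtain ⟨E, hE, hES⟩ := exists_divisor_forall_mem_poleLE (hT.toFinset.biUnion S)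
  refine ⟨E, hE, fun P s hs => ?_⟩
  obtain ⟨V, hV, hPV⟩ : ∃ V ∈ T, P.1 ∈ (V : X.Opens) := by
    simpa only [Opens.mem_iSup, exists_prop] using hcover.le (Opens.mem_top P.1)
  exact hS V P (E P) hPV (fun k hk => hES k
    (Finset.mem_biUnion.2 ⟨V, hT.mem_toFinset.2 hV, hk⟩) P) s hs

end DivisorBound

theorem HasCharP.natCast_functionField_eq_zero [IsIntegral X] {p : ℕ} (hX : HasCharP X p) :
    (p : X.functionField) = 0 := by
  have h := congrArg (X.presheaf.germ ⊤ (genericPoint X) trivial).hom hX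
  rwa [map_natCast, map_zero] at h

section Frobenius

variable {p : ℕ} [Fact p.Prime] {hX : HasCharP X p}

theorem IsFFinite.isFinite_absoluteFrobenius (h : IsFFinite p hX) (e : ℕ) :
    IsFinite (absoluteFrobenius p hX e) := by
  rw [isFinite_iff]
  refine ⟨⟨fun U hU => hU⟩, fun U hU => ?_⟩
  change (frobeniusRingHom p (hX.natCast_eq_zero U) e).Finite
  have hfin : (frobeniusRingHom p (hX.natCast_eq_zero U) 1).Finite := h.finite_app U hU
  induction e with
  | zero =>
    convert RingHom.Finite.id Γ(X, U)
    exact RingHom.ext pow_one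
  | succ e ih =>
    convert hfin.comp ih
    refine RingHom.ext fun a => ?_
    change a ^ p ^ (e + 1) = (a ^ p ^ e) ^ p ^ 1
    rw [← pow_mul, ← pow_add]

variable (hX)

theorem isDominant_absoluteFrobenius (e : ℕ) : IsDominant (absoluteFrobenius p hX e) :=
  ⟨Function.Surjective.denseRange fun x => ⟨x, rfl⟩⟩

theorem stalkMap_absoluteFrobenius (e : ℕ) (x : X) (a : X.presheaf.stalk x) :
    (absoluteFrobenius p hX e).stalkMap x a = a ^ p ^ e := by
  obtain ⟨U, hU, r, rfl⟩ := X.presheaf.exists_germ_eq a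
  exact ((absoluteFrobenius p hX e).germ_stalkMap_apply U x hU r).trans
    (map_pow (X.presheaf.germ U x hU).hom r (p ^ e))

variable [IsIntegral X]

theorem functionFieldMap_absoluteFrobenius (e : ℕ) [IsDominant (absoluteFrobenius p hX e)]
    (k : X.functionField) : functionFieldMap (absoluteFrobenius p hX e) k = k ^ p ^ e := by
  obtain ⟨U, hU, r, rfl⟩ := X.presheaf.exists_germ_eq k
  have : Nonempty U := ⟨⟨_, hU⟩⟩
  have : Nonempty ((absoluteFrobenius p hX e) ⁻¹ᵁ U : X.Opens) := ⟨⟨_, hU⟩⟩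
  exact (functionFieldMap_germToFunctionField (absoluteFrobenius p hX e) r).trans
    (map_pow (X.germToFunctionField U).hom r (p ^ e))

variable [IsLocallyNoetherian X] [IsNormalScheme X]

theorem ramificationIndex_absoluteFrobenius (e : ℕ) (P : PrimeDivisor X) :
    ramificationIndex (absoluteFrobenius p hX e) P.1 = p ^ e := by
  have := isDiscreteValuationRing_stalk P.2
  obtain ⟨ϖ, hϖ⟩ := IsDiscreteValuationRing.exists_irreducible (X.presheaf.stalk P.1)
  have hmap : (IsLocalRing.maximalIdeal (X.presheaf.stalk (absoluteFrobenius p hX e P.1))).map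
      ((absoluteFrobenius p hX e).stalkMap P.1).hom = Ideal.span {ϖ ^ p ^ e} := by
    refine (congrArg (Ideal.map _) hϖ.maximalIdeal_eq).trans ((Ideal.map_span _ _).trans ?_)
    rw [Set.image_singleton]
    exact congrArg (fun a => Ideal.span {a}) (stalkMap_absoluteFrobenius hX e P.1 ϖ)
  rw [ramificationIndex, hmap]
  change (Ring.ord (X.presheaf.stalk P.1) (ϖ ^ p ^ e)).toNat = _
  rw [Ring.ord_pow (mem_nonZeroDivisors_of_ne_zero hϖ.ne_zero), Ring.ord_of_irreducible hϖ]
  simp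

end Frobenius

section FrobeniusSplitting

variable [IsIntegral X] [IsNoetherian X] [IsNormalScheme X] {p : ℕ} [Fact p.Prime]
  {hX : HasCharP X p}

theorem NaturalMapSplits.exists_frobenius_retraction {e : ℕ}
    {A : WeilDivisor X} (h : NaturalMapSplits (absoluteFrobenius p hX e) A) :
    ∃ ψ : X.functionField →+ X.functionField, ψ 1 = 1 ∧ (∀ k s, ψ (k ^ p ^ e * s) = k * ψ s) ∧
      ∀ (P : PrimeDivisor X) (n : ℤ) s, P.PoleLE (A P + p ^ e * n) s → P.PoleLE n (ψ s) := by
  have := isDominant_absoluteFrobenius hX e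
  obtain ⟨ψ, hψ1, hψ, hψA⟩ := h.exists_linear_retraction strictMono_id
  refine ⟨ψ, hψ1, fun k s => ?_, fun P n s hs => ?_⟩
  · rw [← hψ, functionFieldMap_absoluteFrobenius]
  · rw [← zero_add n]
    refine poleLE_add_of_polesOverLE_add_ramificationIndex_mul hψ (hψA P) fun Q hQ => ?_
    obtain rfl : Q = P := Subtype.ext hQ
    simpa only [ramificationIndex_absoluteFrobenius, Nat.cast_pow] using hs

end FrobeniusSplitting

section Rounding

variable {K : Type*} [Field K] [LinearOrder K] [IsStrictOrderedRing K] [FloorRing K] {q δ : K}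

theorem ceil_sub_one_mul_le (hδ : 0 ≤ δ) : (⌈(q - 1) * δ⌉ : K) ≤ (q - 1) * δ + ⌈δ⌉ := by
  rcases hδ.eq_or_lt with rfl | hδ
  · simp
  · have h : (1 : K) ≤ ⌈δ⌉ := by exact_mod_cast Int.one_le_ceil_iff.2 hδ
    linarith [Int.ceil_lt_add_one ((q - 1) * δ)]

theorem ceil_sub_one_mul_add_le_floor {ε : K} {d : ℤ} (hqε : 1 ≤ q * ε) (hδ : 0 ≤ δ) (hd : 0 ≤ d) :
    ⌈(q - 1) * δ⌉ + d ≤ ⌊q * (δ + ε * (d + ⌈δ⌉ : ℤ))⌋ := by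
  have : (0 : K) ≤ (d + ⌈δ⌉ : ℤ) := by exact_mod_cast add_nonneg hd (Int.ceil_nonneg hδ)
  rw [Int.le_floor]
  calc ((⌈(q - 1) * δ⌉ + d : ℤ) : K) ≤ q * δ + 1 * (d + ⌈δ⌉ : ℤ) := by
        push_cast
        linarith [ceil_sub_one_mul_le (q := q) hδ, Int.le_ceil δ]
    _ ≤ q * δ + q * ε * (d + ⌈δ⌉ : ℤ) := by gcongr
    _ = q * (δ + ε * (d + ⌈δ⌉ : ℤ)) := by ring

theorem ceil_mul_add_inv_mul_le {r : ℕ} (hq : q ≠ 0) (d : ℤ) :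
    ⌈r * q * (δ + q⁻¹ * d)⌉ ≤ ⌈(r - 1) * δ⌉ + ⌈δ⌉ + r * (⌈(q - 1) * δ⌉ + d) := by
  rw [Int.ceil_le]
  calc r * q * (δ + q⁻¹ * d) = (r - 1) * δ + δ + r * ((q - 1) * δ + d) := by
        field_simp
        ring
    _ ≤ ⌈(r - 1) * δ⌉ + ⌈δ⌉ + r * (⌈(q - 1) * δ⌉ + d) := by gcongr <;> exact Int.le_ceil _
    _ = _ := by push_cast; rfl

theorem mul_floor_mul_le_mul_ceil_mul (m n : ℕ) (γ : K) : m * ⌊n * γ⌋ ≤ n * ⌈m * γ⌉ := by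
  have h : (m * ⌊n * γ⌋ : K) ≤ n * ⌈m * γ⌉ :=
    calc (m * ⌊n * γ⌋ : K) ≤ m * (n * γ) := by gcongr; exact Int.floor_le _
      _ = n * (m * γ) := by ring
      _ ≤ n * ⌈m * γ⌉ := by gcongr; exact Int.le_ceil _
  exact_mod_cast h

end Rounding

section Pullback

theorem QDivisor.pullback_apply (f : Y ⟶ X) [IsFinite f] (Δ : QDivisor X) {Q : PrimeDivisor Y}
    {P : PrimeDivisor X} (h : f Q.1 = P.1) :
    QDivisor.pullback f Δ Q = ramificationIndex f Q.1 * Δ P := by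
  obtain ⟨x, hx⟩ := P
  obtain rfl : f Q.1 = x := h
  exact dif_pos hx

theorem QDivisor.floor_pullback_nonneg (f : Y ⟶ X) [IsFinite f] {Δ : QDivisor X} (hΔ : 0 ≤ Δ) :
    0 ≤ QDivisor.floor (QDivisor.pullback f Δ) := by
  intro Q
  change 0 ≤ ⌊pullbackCoeff f Δ Q⌋
  rw [Int.floor_nonneg, pullbackCoeff]
  split_ifs
  exacts [mul_nonneg (Nat.cast_nonneg _) (hΔ _), le_rfl]

theorem QDivisor.ceil_nonneg {Δ : QDivisor X} (hΔ : 0 ≤ Δ) : 0 ≤ QDivisor.ceil Δ :=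
  fun P => Int.ceil_nonneg (α := ℚ) (hΔ P)

theorem PolesOverLE.pow [IsIntegral Y] [IsLocallyNoetherian Y] {f : Y ⟶ X} [IsFinite f]
    {Γ : QDivisor X} {P : PrimeDivisor X} {s : Y.functionField}
    (h : PolesOverLE f P.1 (QDivisor.floor (QDivisor.pullback f Γ)) s) (q : ℕ) :
    PolesOverLE f P.1 (fun Q => ramificationIndex f Q.1 * ⌈q * Γ P⌉) (s ^ q) := by
  refine fun Q hQ => ((h Q hQ).pow q).mono ?_
  change (q : ℤ) * ⌊QDivisor.pullback f Γ Q⌋ ≤ _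
  rw [QDivisor.pullback_apply f Γ hQ]
  exact mul_floor_mul_le_mul_ceil_mul q _ (Γ P)

end Pullback

section GlobalRegularity

variable [IsIntegral X] [IsNormalScheme X] {p : ℕ} [hp : Fact p.Prime] {hX : HasCharP X p}
  {Δ : QDivisor X}

theorem QDivisor.ceil_add_le_floor_pullback_absoluteFrobenius [IsLocallyNoetherian X] (e : ℕ)
    [IsFinite (absoluteFrobenius p hX e)] (hΔ : 0 ≤ Δ) {D : WeilDivisor X} (hD : 0 ≤ D) {ε : ℚ}
    (hε : 1 ≤ (p : ℚ) ^ e * ε) :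
    QDivisor.ceil (((p : ℚ) ^ e - 1) • Δ) + D ≤ QDivisor.floor
      (QDivisor.pullback (absoluteFrobenius p hX e) (Δ + ε • (D + QDivisor.ceil Δ).toQ)) := by
  intro P
  change ⌈((p : ℚ) ^ e - 1) * Δ P⌉ + D P ≤ ⌊QDivisor.pullback (absoluteFrobenius p hX e) _ P⌋
  rw [QDivisor.pullback_apply (absoluteFrobenius p hX e) _ (P := P) rfl,
    ramificationIndex_absoluteFrobenius, Nat.cast_pow]
  exact ceil_sub_one_mul_add_le_floor hε (hΔ P) (hD P)

theorem IsStronglyGloballyPlusRegular.isGloballyFRegular [IsLocallyNoetherian X]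
    (hF : IsFFinite p hX) (hΔ : 0 ≤ Δ) (h : IsStronglyGloballyPlusRegular Δ) :
    IsGloballyFRegular p hX Δ := by
  intro D hD
  obtain ⟨ε, hε, hreg⟩ := h (D + QDivisor.ceil Δ) (add_nonneg hD (QDivisor.ceil_nonneg hΔ))
  have hp1 : (1 : ℚ) < p := by exact_mod_cast hp.out.one_lt
  obtain ⟨e, he, hεe⟩ := ((Filter.eventually_gt_atTop 0).and
    ((tendsto_pow_atTop_atTop_of_one_lt hp1).eventually_ge_atTop ε⁻¹)).exists
  have := hF.isFinite_absoluteFrobenius e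
  have := isDominant_absoluteFrobenius hX e
  have hceil : 0 ≤ QDivisor.ceil (((p : ℚ) ^ e - 1) • Δ) :=
    QDivisor.ceil_nonneg fun P => mul_nonneg (sub_nonneg.2 (one_le_pow₀ hp1.le)) (hΔ P)
  exact ⟨e, he, (hreg X (absoluteFrobenius p hX e)).mono (add_nonneg hceil hD)
    (QDivisor.ceil_add_le_floor_pullback_absoluteFrobenius e hΔ hD
      ((inv_le_iff_one_le_mul₀ hε).1 hεe))⟩

theorem NaturalMapSplits.floor_pullback_of_absoluteFrobenius [IsNoetherian X] [IsIntegral Y]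
    [IsLocallyNoetherian Y] [IsNormalScheme Y] (f : Y ⟶ X) [IsFinite f] [IsDominant f]
    {e₀ e₁ : ℕ} {D E : WeilDivisor X} {Γ : QDivisor X} (hΓ : 0 ≤ Γ)
    {φ : Y.functionField →+ X.functionField} (hφ1 : φ 1 = 1)
    (hφ : ∀ k s, φ (functionFieldMap f k * s) = k * φ s)
    (hφE : ∀ (P : PrimeDivisor X) s, PolesOverLE f P.1 0 s → P.PoleLE (E P) (φ s))
    (h₀ : NaturalMapSplits (absoluteFrobenius p hX e₀) D)
    {A : WeilDivisor X} (h₁ : NaturalMapSplits (absoluteFrobenius p hX e₁) A)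
    (hA : ∀ P, E P + ⌈(p : ℚ) ^ (e₀ + e₁) * Γ P⌉ ≤ A P + p ^ e₁ * D P) :
    NaturalMapSplits f (QDivisor.floor (QDivisor.pullback f Γ)) := by
  have := isDominant_absoluteFrobenius hX e₀
  obtain ⟨ψ, hψ1, hψ, hψA⟩ := h₁.exists_frobenius_retraction
  have hYp : (p : Y.functionField) = 0 := by
    rw [← map_natCast (functionFieldMap f), hX.natCast_functionField_eq_zero, map_zero]
  let θ : Y.functionField →+ X.functionField :=
    ψ.comp (φ.comp (frobeniusRingHom p hYp (e₀ + e₁)).toAddMonoidHom)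
  have hθ (s) : θ s = ψ (φ (s ^ p ^ (e₀ + e₁))) := rfl
  refine .of_transfer (QDivisor.floor_pullback_nonneg f hΓ) θ ?_ (fun k s => ?_)
    (fun P s hs => ?_) h₀
  · rw [hθ, one_pow, hφ1, hψ1]
  · rw [hθ, hθ, functionFieldMap_absoluteFrobenius, mul_pow, ← map_pow, hφ, pow_add, pow_mul, hψ]
  · have hpow : PolesOverLE f P.1 (fun Q => (0 : PrimeDivisor Y → ℤ) Q +
        ramificationIndex f Q.1 * ⌈(p : ℚ) ^ (e₀ + e₁) * Γ P⌉) (s ^ p ^ (e₀ + e₁)) := by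
      simpa only [Pi.zero_apply, zero_add, Nat.cast_pow] using PolesOverLE.pow hs (p ^ (e₀ + e₁))
    exact hψA P _ _ ((poleLE_add_of_polesOverLE_add_ramificationIndex_mul hφ (hφE P) hpow).mono
      (hA P))

theorem IsGloballyFRegular.isStronglyGloballyPlusRegular [IsNoetherian X] (hΔ : 0 ≤ Δ)
    (h : IsGloballyFRegular p hX Δ) : IsStronglyGloballyPlusRegular Δ := by
  intro D hD
  obtain ⟨e₀, -, h₀⟩ := h D hD
  have hq : (0 : ℚ) < (p : ℚ) ^ e₀ := pow_pos (by exact_mod_cast hp.out.pos) _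
  refine ⟨((p : ℚ) ^ e₀)⁻¹, inv_pos.2 hq, ?_⟩
  intro Y _ _ _ f _ _
  obtain ⟨φ, hφ1, hφ⟩ := exists_linear_retraction_functionFieldMap f
  obtain ⟨E, hE, hφE⟩ := exists_divisor_poleLE_map hφ
  obtain ⟨e₁, -, h₁⟩ := h (QDivisor.ceil Δ + E) (add_nonneg (QDivisor.ceil_nonneg hΔ) hE)
  have hΓ : 0 ≤ Δ + ((p : ℚ) ^ e₀)⁻¹ • D.toQ :=
    add_nonneg hΔ fun P => mul_nonneg (inv_pos.2 hq).le (Int.cast_nonneg (hD P))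
  refine .floor_pullback_of_absoluteFrobenius f hΓ hφ1 hφ hφE h₀ h₁ fun P => ?_
  have hceil := ceil_mul_add_inv_mul_le (r := p ^ e₁) (δ := Δ P) hq.ne' (D P)
  rw [Nat.cast_pow, ← pow_add, add_comm e₁] at hceil
  change E P + ⌈(p : ℚ) ^ (e₀ + e₁) * (Δ P + ((p : ℚ) ^ e₀)⁻¹ * D P)⌉ ≤
    ⌈((p : ℚ) ^ e₁ - 1) * Δ P⌉ + (⌈Δ P⌉ + E P) + p ^ e₁ * (⌈((p : ℚ) ^ e₀ - 1) * Δ P⌉ + D P)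
  push_cast at hceil
  linarith

end GlobalRegularity

end PlusRegular

end

theorem mainTheorem8_general (p : ℕ) [Fact p.Prime] (X : Scheme.{u}) [IsIntegral X] [IsNoetherian X]
    [PlusRegular.IsNormalScheme X] (hX : PlusRegular.HasCharP X p)
    (hF : PlusRegular.IsFFinite p hX) (Δ : PlusRegular.QDivisor X) (hΔ : 0 ≤ Δ) :
    PlusRegular.IsGloballyFRegular p hX Δ ↔ PlusRegular.IsStronglyGloballyPlusRegular Δ :=
  ⟨fun h => h.isStronglyGloballyPlusRegular hΔ, fun h => h.isGloballyFRegular hF hΔ⟩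

theorem mainTheorem8 {k : Type u} [Field k] (p : ℕ) [Fact p.Prime] [CharP k p]
    (X : Scheme.{u}) [IsIntegral X] [IsLocallyNoetherian X] [PlusRegular.IsNormalScheme X]
    (s : X ⟶ Spec (CommRingCat.of k)) [IsSeparated s] [LocallyOfFiniteType s] [QuasiCompact s]
    (hF : PlusRegular.IsFFinite p (PlusRegular.HasCharP.of_hom_spec p s))
    (Δ : PlusRegular.QDivisor X) (hΔ : 0 ≤ Δ) :
    PlusRegular.IsGloballyFRegular p (PlusRegular.HasCharP.of_hom_spec p s) Δ ↔
      PlusRegular.IsStronglyGloballyPlusRegular Δ := by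
  have : CompactSpace X := QuasiCompact.compactSpace_of_compactSpace s
  have : IsNoetherian X := {}
  exact mainTheorem8_general p X (.of_hom_spec p s) hF Δ hΔ
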